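/- All manifolds are smooth, without boundary, finite dimensional, Hausdorff and second countable. For a Riemannian manifold $(M,g)$ with Levi-Civita connection $\nabla$ let $R_{XY}Z=\nabla_X\nabla_YZ-\nabla_Y\nabla_XZ-\nabla_{[X,Y]}Z$ and $R(X,Y,Z,W)=-g(R_{XY}Z,W)$. An almost Hermitian manifold $(N,J,\bar g)$ (that is, $J^2=-I$ and $\bar g(JX,JY)=\bar g(X,Y)$, with $\bar g$ Riemannian and $\bar g$, $J$ smooth) with curvature $\bar R$ is called - $K2$ if $\bar R(X,Y,Z,W)=\bar R(JX,JY,Z,W)+\bar R(JX,Y,JZ,W)+\bar R(JX,Y,Z,JW)$ for all $X,Y,Z,W$, - $K3$ if $\bar R(X,Y,Z,W)=\bar R(JX,JY,JZ,JW)$ for all $X,Y,Z,W$. An almost contact metric manifold $(M,\varphi,\xi,\eta,g)$ (that is, $\varphi^2=-I+\eta\otimes\xi$, $\eta(\xi)=1$ and $g(\varphi X,\varphi Y)=g(X,Y)-\eta(X)\eta(Y)$) is called - $G2$ if $R(X,Y,Z,W)=R(\varphi X,Y,Z,\varphi W)+R(X,\varphi Y,Z,\varphi W)+R(X,Y,\varphi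 Z,\varphi W)+g(X,Z)\eta(W)\eta(Y)-g(Z,Y)\eta(X)\eta(W)$ for all $X,Y,Z,W$, - $G3$ if $R(X,Y,Z,W)=R(\varphi X,\varphi Y,\varphi Z,\varphi W)+g(X,Z)\eta(W)\eta(Y)-g(Z,Y)\eta(X)\eta(W)+g(Y,W)\eta(X)\eta(Z)-g(X,W)\eta(Y)\eta(Z)$ for all $X,Y,Z,W$. Let $(N,J,\bar g)$ be an almost Hermitian manifold, let $\alpha,\beta\in\mathbf R$, put $f(\theta)=\alpha\cos\theta+\beta\sin\theta$, and let $S\subseteq\mathbf R$ be a nonempty open set (for instance an open interval) with $f>0$ on $S$. Let $M=S\times_fN$ be the warped product, i.e. the manifold $S\times N$ with the metric $g=d\theta^2+f(\theta)^2\bar g$, and equip it with the almost contact metric structure given by $\xi=\partial/\partial\theta$, $\eta=d\theta$, $\varphi\xi=0$, and $\varphi X=JX$ for $X$ tangent to $N$. Then $M$ is $G2$ if and only if $N$ is $K2$, and $M$ is $G3$ if and only if $N$ is $K3$. -/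

import Mathlib

open Bundle Manifold
open scoped ContDiff Topology

noncomputable section

namespace GrayCurvature

section Chart

variable {E : Type*} [NormedAddCommGroup E] [NormedSpace ℝ E]

/-- Christoffel symbols of the second kind of a metric `G` on (an open part of) a vector space,
as a bilinear map: `christoffel G y u v` is the vector `Γ` with
`G (Γ, w) = 1/2 (∂_u G (v, w) + ∂_v G (u, w) - ∂_w G (u, v))` for all `w`. -/
def christoffel (G : E → E →L[ℝ] E →L[ℝ] ℝ) (y u v : E) : E :=
  (G y).inverse ((1 / 2 : ℝ) •
    (fderiv ℝ G y u v + fderiv ℝ G y v u - ((fderiv ℝ G y).flip u).flip v))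

/-- The Levi-Civita covariant derivative `∇_X Y = ∂_X Y + Γ(X, Y)` of the metric `G`. -/
def covDeriv (G : E → E →L[ℝ] E →L[ℝ] ℝ) (X Y : E → E) (y : E) : E :=
  fderiv ℝ Y y (X y) + christoffel G y (X y) (Y y)

/-- The curvature `R_{XY} Z = ∇_X ∇_Y Z - ∇_Y ∇_X Z - ∇_{[X,Y]} Z`. -/
def curvatureOp (G : E → E →L[ℝ] E →L[ℝ] ℝ) (X Y Z : E → E) (y : E) : E :=
  covDeriv G X (covDeriv G Y Z) y - covDeriv G Y (covDeriv G X Z) y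
    - covDeriv G (VectorField.lieBracket ℝ X Y) Z y

end Chart

section Manifold

variable {E : Type*} [NormedAddCommGroup E] [NormedSpace ℝ E]
  {H : Type*} [TopologicalSpace H] (I : ModelWithCorners ℝ E H)
  (M : Type*) [TopologicalSpace M] [ChartedSpace H M] [IsManifold I ∞ M]

/-- Smooth Riemannian metrics on the manifold `M`. -/
abbrev Metric := ContMDiffRiemannianMetric I ∞ E (TangentSpace I : M → Type _)

variable {I M}

/-- The components of the metric `g` in the preferred chart `φ` at `p`, i.e. the pullback of `g` by
`φ⁻¹`, for a manifold without boundary. -/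
def metricInChart (g : Metric I M) (p : M) (y : E) : E →L[ℝ] E →L[ℝ] ℝ :=
  let D : E →L[ℝ] E := mfderiv 𝓘(ℝ, E) I (extChartAt I p).symm y
  let B : E →L[ℝ] E →L[ℝ] ℝ := g.inner ((extChartAt I p).symm y)
  B.bilinearComp D D

/-- The Riemann-Christoffel curvature tensor `R(u, v, w, z) = - g (R_{uv} w, z)` at the point `p`
of a manifold without boundary. Since `R` is a tensor, it is computed by extending `u`, `v`, `w` to
vector fields with constant components in the preferred chart at `p`. -/
def riemann (g : Metric I M) (p : M) (u v w z : TangentSpace I p) : ℝ :=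
  let φ := extChartAt I p
  let d : TangentSpace I p →L[ℝ] E := mfderiv I 𝓘(ℝ, E) φ p
  let G := metricInChart g p;
  -(G (φ p) (curvatureOp G (fun _ => d u) (fun _ => d v) (fun _ => d w) (φ p)) (d z))

variable (I M)

/-- An almost Hermitian structure on `M`: a Riemannian metric `g` and a smooth almost complex
structure `J` that is orthogonal for `g`. -/
structure AlmostHermitian where
  g : Metric I M
  J : ∀ p : M, TangentSpace I p →L[ℝ] TangentSpace I p
  contMDiff_J : ContMDiff I (I.prod 𝓘(ℝ, E →L[ℝ] E)) ∞
    (fun p => TotalSpace.mk' (E →L[ℝ] E)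
      (E := fun p : M => TangentSpace I p →L[ℝ] TangentSpace I p) p (J p))
  J_J : ∀ (p : M) (u : TangentSpace I p), J p (J p u) = -u
  g_J_J : ∀ (p : M) (u v : TangentSpace I p), g.inner p (J p u) (J p v) = g.inner p u v

/-- An almost contact metric structure `(φ, ξ, η, g)` on `M`. -/
structure AlmostContactMetric where
  g : Metric I M
  φ : ∀ p : M, TangentSpace I p →L[ℝ] TangentSpace I p
  ξ : ∀ p : M, TangentSpace I p
  η : ∀ p : M, TangentSpace I p →L[ℝ] ℝ
  contMDiff_φ : ContMDiff I (I.prod 𝓘(ℝ, E →L[ℝ] E)) ∞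
    (fun p => TotalSpace.mk' (E →L[ℝ] E)
      (E := fun p : M => TangentSpace I p →L[ℝ] TangentSpace I p) p (φ p))
  contMDiff_ξ : ContMDiff I (I.prod 𝓘(ℝ, E)) ∞
    (fun p => TotalSpace.mk' E (E := (TangentSpace I : M → Type _)) p (ξ p))
  contMDiff_η : ContMDiff I (I.prod 𝓘(ℝ, E →L[ℝ] ℝ)) ∞
    (fun p => TotalSpace.mk' (E →L[ℝ] ℝ) (E := fun p : M => TangentSpace I p →L[ℝ] ℝ) p (η p))
  φ_φ : ∀ (p : M) (u : TangentSpace I p), φ p (φ p u) = -u + η p u • ξ p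
  η_ξ : ∀ p : M, η p (ξ p) = 1
  g_φ_φ : ∀ (p : M) (u v : TangentSpace I p),
    g.inner p (φ p u) (φ p v) = g.inner p u v - η p u * η p v

variable {I M}

/-- The Gray identity (K2). -/
def AlmostHermitian.IsK2 (h : AlmostHermitian I M) : Prop :=
  ∀ (p : M) (X Y Z W : TangentSpace I p),
    riemann h.g p X Y Z W =
      riemann h.g p (h.J p X) (h.J p Y) Z W + riemann h.g p (h.J p X) Y (h.J p Z) W
        + riemann h.g p (h.J p X) Y Z (h.J p W)

/-- The Gray identity (K3). -/
def AlmostHermitian.IsK3 (h : AlmostHermitian I M) : Prop :=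
  ∀ (p : M) (X Y Z W : TangentSpace I p),
    riemann h.g p X Y Z W = riemann h.g p (h.J p X) (h.J p Y) (h.J p Z) (h.J p W)

/-- The identity (G2). -/
def AlmostContactMetric.IsG2 (c : AlmostContactMetric I M) : Prop :=
  ∀ (p : M) (X Y Z W : TangentSpace I p),
    riemann c.g p X Y Z W =
      riemann c.g p (c.φ p X) Y Z (c.φ p W) + riemann c.g p X (c.φ p Y) Z (c.φ p W)
        + riemann c.g p X Y (c.φ p Z) (c.φ p W)
        + c.g.inner p X Z * c.η p W * c.η p Y - c.g.inner p Z Y * c.η p X * c.η p W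

/-- The identity (G3). -/
def AlmostContactMetric.IsG3 (c : AlmostContactMetric I M) : Prop :=
  ∀ (p : M) (X Y Z W : TangentSpace I p),
    riemann c.g p X Y Z W =
      riemann c.g p (c.φ p X) (c.φ p Y) (c.φ p Z) (c.φ p W)
        + c.g.inner p X Z * c.η p W * c.η p Y - c.g.inner p Z Y * c.η p X * c.η p W
        + c.g.inner p Y W * c.η p X * c.η p Z - c.g.inner p X W * c.η p Y * c.η p Z

end Manifold

section Helpers

variable {E : Type*} [NormedAddCommGroup E] [NormedSpace ℝ E]
  {H : Type*} [TopologicalSpace H] {I : ModelWithCorners ℝ E H}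
  {M : Type*} [TopologicalSpace M] [ChartedSpace H M]

/-- A family of linear maps on tangent spaces is smooth if it maps smooth local vector fields to
smooth local sections. -/
theorem contMDiffAt_hom_of_forall [FiniteDimensional ℝ E] [IsManifold I ∞ M]
    {F : Type*} [NormedAddCommGroup F] [NormedSpace ℝ F] {V : M → Type*}
    [TopologicalSpace (TotalSpace F V)] [∀ x, AddCommGroup (V x)] [∀ x, Module ℝ (V x)]
    [∀ x, TopologicalSpace (V x)] [FiberBundle F V] [VectorBundle ℝ F V]
    [∀ x, IsTopologicalAddGroup (V x)] [∀ x, ContinuousSMul ℝ (V x)]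
    {x₀ : M} (A : ∀ x : M, TangentSpace I x →L[ℝ] V x)
    (hA : ∀ v : ∀ x : M, TangentSpace I x,
      ContMDiffAt I (I.prod 𝓘(ℝ, E)) ∞
        (fun x => TotalSpace.mk' E (E := (TangentSpace I : M → Type _)) x (v x)) x₀ →
      ContMDiffAt I (I.prod 𝓘(ℝ, F)) ∞ (fun x => TotalSpace.mk' F x (A x (v x))) x₀) :
    ContMDiffAt I (I.prod 𝓘(ℝ, E →L[ℝ] F)) ∞
      (fun x => TotalSpace.mk' (E →L[ℝ] F)
        (E := fun x : M => TangentSpace I x →L[ℝ] V x) x (A x)) x₀ := by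
  rw [contMDiffAt_hom_bundle]
  refine ⟨contMDiffAt_id, ?_⟩
  -- it suffices to check smoothness after evaluation at each vector
  have key : ∀ e : E, ContMDiffAt I 𝓘(ℝ, F) ∞
      (fun x => ContinuousLinearMap.inCoordinates E (TangentSpace I : M → Type _) F V x₀ x x₀ x
        (A x) e) x₀ := by
    intro e
    have hs : ContMDiffAt I (I.prod 𝓘(ℝ, E)) ∞
        (fun x => TotalSpace.mk' E (E := (TangentSpace I : M → Type _)) x
          ((trivializationAt E (TangentSpace I : M → Type _) x₀).symmL ℝ x e)) x₀ := by
      have h1 := (trivializationAt E (TangentSpace I : M → Type _) x₀).contMDiffAt_symmL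
        (IB := I) (n := ∞) (mem_baseSet_trivializationAt E (TangentSpace I : M → Type _) x₀)
      have h2 : ContMDiffAt I (I.prod 𝓘(ℝ, E)) ∞
        (fun x => TotalSpace.mk' E (E := Bundle.Trivial M E) x e) x₀ := by
        rw [contMDiffAt_section]
        exact contMDiffAt_const
      exact ContMDiffAt.clm_bundle_apply (F₁ := E) (F₂ := E) (b := fun x => x) h1 h2
    have h3 := (contMDiffAt_section x₀).1 (hA _ hs)
    refine h3.congr_of_eventuallyEq ?_
    filter_upwards [(trivializationAt F V x₀).open_baseSet.mem_nhds
      (mem_baseSet_trivializationAt F V x₀)] with x hx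
    simp [ContinuousLinearMap.inCoordinates, Trivialization.coe_linearMapAt_of_mem _ hx]
  let b := Module.finBasis ℝ E
  let L : (Fin (Module.finrank ℝ E) → F) →L[ℝ] (E →L[ℝ] F) :=
    ∑ i, (ContinuousLinearMap.smulRightL ℝ E F
      (LinearMap.toContinuousLinearMap (b.coord i))).comp (ContinuousLinearMap.proj i)
  have hL : ContMDiffAt I 𝓘(ℝ, E →L[ℝ] F) ∞
      (fun x => L (fun i => ContinuousLinearMap.inCoordinates E (TangentSpace I : M → Type _) F V
        x₀ x x₀ x (A x) (b i))) x₀ :=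
    L.contMDiff.contMDiffAt.comp x₀ (contMDiffAt_pi_space.2 fun i => key (b i))
  refine hL.congr_of_eventuallyEq (Filter.Eventually.of_forall fun x => ?_)
  ext e
  let T : E →L[ℝ] F := ContinuousLinearMap.inCoordinates E (TangentSpace I : M → Type _) F V
    x₀ x x₀ x (A x)
  have hT : T e = ∑ i, b.repr e i • T (b i) := by
    conv_lhs => rw [← b.sum_repr e]
    simp only [map_sum, map_smul]
  simpa [L] using hT

/-- The inclusion of an open subset of `ℝ` has derivative the identity. -/
theorem mfderiv_coe_opens (S : TopologicalSpace.Opens ℝ) (t : S) :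
    HasMFDerivAt 𝓘(ℝ, ℝ) 𝓘(ℝ, ℝ) (fun t : S => (t : ℝ)) t (ContinuousLinearMap.id ℝ ℝ) := by
  refine ⟨continuous_subtype_val.continuousAt, ?_⟩
  have := TopologicalSpace.Opens.chartAt_subtype_val_symm_eventuallyEq S (x := t) (H := ℝ)
  refine HasFDerivAt.hasFDerivWithinAt ?_
  refine (hasFDerivAt_id _).congr_of_eventuallyEq ?_
  filter_upwards [this] with y hy
  simpa [writtenInExtChartAt, extChartAt, chartAt_self_eq] using hy.symm

/-- The coordinate vector field of an open subset of `ℝ` is smooth. -/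
theorem contMDiff_dθ (S : TopologicalSpace.Opens ℝ) :
    ContMDiff 𝓘(ℝ, ℝ) (𝓘(ℝ, ℝ).prod 𝓘(ℝ, ℝ)) ∞
      (fun t : S => TotalSpace.mk' ℝ (E := (TangentSpace 𝓘(ℝ, ℝ) : S → Type _)) t (1 : ℝ)) := by
  intro t₀
  refine (contMDiffAt_section (F := ℝ) (E := (TangentSpace 𝓘(ℝ, ℝ) : S → Type _))
    (s := fun _ => (1 : ℝ)) t₀).2 ?_
  refine (contMDiffAt_const (c := (1 : ℝ))).congr_of_eventuallyEq
    (Filter.Eventually.of_forall fun t => ?_)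
  have ht : t ∈ (chartAt ℝ t₀).source := by
    simp [TopologicalSpace.Opens.chartAt_eq, chartAt_self_eq]
  have h1 := TangentBundle.continuousLinearMapAt_trivializationAt (I := 𝓘(ℝ, ℝ)) ht
  have h2 : (extChartAt 𝓘(ℝ, ℝ) t₀ : S → ℝ) = fun t : S => (t : ℝ) := by
    ext t
    simp [extChartAt, TopologicalSpace.Opens.chartAt_eq, chartAt_self_eq]
  rw [h2, (mfderiv_coe_opens S t).mfderiv] at h1
  have h3 := congrArg (fun L : ℝ →L[ℝ] ℝ => L 1) h1
  have hb : t ∈ (trivializationAt ℝ (TangentSpace 𝓘(ℝ, ℝ) : S → Type _) t₀).baseSet := ht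
  refine Eq.trans ?_ h3
  exact (congrFun (Trivialization.coe_linearMapAt_of_mem (R := ℝ) _ hb) _).symm

variable {N : Type*} [TopologicalSpace N] [ChartedSpace E N]
  [IsManifold 𝓘(ℝ, E) ∞ N] {S : TopologicalSpace.Opens ℝ}

theorem contMDiffAt_snd_vec {p : S × N} {v : ∀ q : S × N, TangentSpace (𝓘(ℝ, ℝ).prod 𝓘(ℝ, E)) q}
    (hv : ContMDiffAt (𝓘(ℝ, ℝ).prod 𝓘(ℝ, E)) ((𝓘(ℝ, ℝ).prod 𝓘(ℝ, E)).prod 𝓘(ℝ, ℝ × E)) ∞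
      (fun q => TotalSpace.mk' (ℝ × E)
        (E := (TangentSpace (𝓘(ℝ, ℝ).prod 𝓘(ℝ, E)) : S × N → Type _)) q (v q)) p) :
    ContMDiffAt (𝓘(ℝ, ℝ).prod 𝓘(ℝ, E)) (𝓘(ℝ, E).prod 𝓘(ℝ, E)) ∞
      (fun q => TotalSpace.mk' E (E := (TangentSpace 𝓘(ℝ, E) : N → Type _)) q.2 (v q).2) p := by
  have h := (contMDiff_equivTangentBundleProd (n := ∞) (I := 𝓘(ℝ, ℝ)) (M := S)
    (I' := 𝓘(ℝ, E)) (M' := N)).contMDiffAt.comp p hv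
  exact h.snd

theorem contMDiffAt_fst_vec {p : S × N} {v : ∀ q : S × N, TangentSpace (𝓘(ℝ, ℝ).prod 𝓘(ℝ, E)) q}
    (hv : ContMDiffAt (𝓘(ℝ, ℝ).prod 𝓘(ℝ, E)) ((𝓘(ℝ, ℝ).prod 𝓘(ℝ, E)).prod 𝓘(ℝ, ℝ × E)) ∞
      (fun q => TotalSpace.mk' (ℝ × E)
        (E := (TangentSpace (𝓘(ℝ, ℝ).prod 𝓘(ℝ, E)) : S × N → Type _)) q (v q)) p) :
    ContMDiffAt (𝓘(ℝ, ℝ).prod 𝓘(ℝ, E)) 𝓘(ℝ, ℝ) ∞ (fun q => ((v q).1 : ℝ)) p := by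
  have h := (contMDiff_equivTangentBundleProd (n := ∞) (I := 𝓘(ℝ, ℝ)) (M := S)
    (I' := 𝓘(ℝ, E)) (M' := N)).contMDiffAt.comp p hv
  have h1 : ContMDiff (𝓘(ℝ, ℝ).prod 𝓘(ℝ, ℝ)) (𝓘(ℝ, ℝ).prod 𝓘(ℝ, ℝ)) ∞
    (tangentMap 𝓘(ℝ, ℝ) 𝓘(ℝ, ℝ) (fun t : S => (t : ℝ))) :=
    (contMDiff_subtype_val (n := ∞)).contMDiff_tangentMap le_rfl
  have h2 := (contMDiff_snd_tangentBundle_modelSpace ℝ 𝓘(ℝ, ℝ) (n := ∞)).comp h1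
  have h3 := h2.contMDiffAt.comp p h.fst
  refine h3.congr_of_eventuallyEq (Filter.Eventually.of_forall fun q => ?_)
  change ((v q).1 : ℝ) = mfderiv 𝓘(ℝ, ℝ) 𝓘(ℝ, ℝ) (fun t : S => (t : ℝ)) q.1 (v q).1
  rw [(mfderiv_coe_opens S _).mfderiv]
  rfl

theorem contMDiffAt_mk_vec {p : S × N} {a : ∀ q : S × N, TangentSpace 𝓘(ℝ, ℝ) q.1}
    {u : ∀ q : S × N, TangentSpace 𝓘(ℝ, E) q.2}
    (ha : ContMDiffAt (𝓘(ℝ, ℝ).prod 𝓘(ℝ, E)) (𝓘(ℝ, ℝ).prod 𝓘(ℝ, ℝ)) ∞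
      (fun q => TotalSpace.mk' ℝ (E := (TangentSpace 𝓘(ℝ, ℝ) : S → Type _)) q.1 (a q)) p)
    (hu : ContMDiffAt (𝓘(ℝ, ℝ).prod 𝓘(ℝ, E)) (𝓘(ℝ, E).prod 𝓘(ℝ, E)) ∞
      (fun q => TotalSpace.mk' E (E := (TangentSpace 𝓘(ℝ, E) : N → Type _)) q.2 (u q)) p) :
    ContMDiffAt (𝓘(ℝ, ℝ).prod 𝓘(ℝ, E)) ((𝓘(ℝ, ℝ).prod 𝓘(ℝ, E)).prod 𝓘(ℝ, ℝ × E)) ∞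
      (fun q => TotalSpace.mk' (ℝ × E)
        (E := (TangentSpace (𝓘(ℝ, ℝ).prod 𝓘(ℝ, E)) : S × N → Type _)) q
          ((a q, u q) : ℝ × E)) p :=
  (contMDiff_equivTangentBundleProd_symm (n := ∞) (I := 𝓘(ℝ, ℝ)) (M := S)
    (I' := 𝓘(ℝ, E)) (M' := N)).contMDiffAt.comp p (ha.prodMk hu)

end Helpers

section Product
variable {E : Type*} [NormedAddCommGroup E] [NormedSpace ℝ E] [FiniteDimensional ℝ E]
  {N : Type*} [TopologicalSpace N] [ChartedSpace E N] [IsManifold 𝓘(ℝ, E) ∞ N]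
  {S : TopologicalSpace.Opens ℝ}

/-- The warped product metric `dθ² + f(θ)² g` on `S × N`, for an open set `S` of real numbers and
a smooth positive function `f` on `S`. Tangent vectors of `S × N` are pairs. -/
def warpedMetric (f : ℝ → ℝ) (hf : ContDiff ℝ ∞ f) (hpos : ∀ θ ∈ S, 0 < f θ)
    (g : Metric 𝓘(ℝ, E) N) : Metric (𝓘(ℝ, ℝ).prod 𝓘(ℝ, E)) (S × N) where
  inner p :=
    let a : ℝ × E →L[ℝ] ℝ := ContinuousLinearMap.fst ℝ ℝ E
    let t : ℝ × E →L[ℝ] E := ContinuousLinearMap.snd ℝ ℝ E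
    let B : E →L[ℝ] E →L[ℝ] ℝ := g.inner p.2
    (ContinuousLinearMap.mul ℝ ℝ).bilinearComp a a + (f p.1) ^ 2 • B.bilinearComp t t
  symm p v w := by
    have h := g.symm p.2 v.2 w.2
    change (v.1 : ℝ) * w.1 + f p.1 ^ 2 * g.inner p.2 v.2 w.2
      = (w.1 : ℝ) * v.1 + f p.1 ^ 2 * g.inner p.2 w.2 v.2
    rw [h, mul_comm (v.1 : ℝ)]
  pos p v hv := by
    change 0 < (v.1 : ℝ) * v.1 + f p.1 ^ 2 * g.inner p.2 v.2 v.2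
    have hf0 : 0 < f p.1 ^ 2 := pow_pos (hpos _ p.1.2) 2
    by_cases h2 : v.2 = 0
    · have h1 : (v.1 : ℝ) ≠ 0 := fun h1 => hv (Prod.ext h1 h2)
      have h3 : g.inner p.2 v.2 v.2 = 0 := by
        have h4 : g.inner p.2 v.2 = 0 := by
          rw [show (v.2 : TangentSpace 𝓘(ℝ, E) p.2) = 0 from h2]
          exact map_zero _
        rw [h4]
        rfl
      rw [h3, mul_zero, add_zero]
      exact mul_self_pos.2 h1
    · have := mul_pos hf0 (g.pos p.2 v.2 h2)
      nlinarith [mul_self_nonneg (v.1 : ℝ)]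
  isVonNBounded p := by
    let B : E →L[ℝ] E →L[ℝ] ℝ := g.inner p.2
    have hB : Bornology.IsVonNBounded ℝ {u : E | B u u < 1} := g.isVonNBounded p.2
    change Bornology.IsVonNBounded ℝ {v : ℝ × E | v.1 * v.1 + f p.1 ^ 2 * B v.2 v.2 < 1}
    have hf0 : 0 < f p.1 := hpos _ p.1.2
    have hBnn : ∀ u : E, 0 ≤ B u u := fun u => by
      by_cases hu : u = 0
      · simp [hu]
      · exact (g.pos p.2 u hu).le
    rw [NormedSpace.isVonNBounded_iff] at hB ⊢
    obtain ⟨C, hC⟩ := isBounded_iff_forall_norm_le.1 hB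
    refine isBounded_iff_forall_norm_le.2 ⟨max 1 (C / f p.1), fun v hv => ?_⟩
    have hv' : v.1 * v.1 + f p.1 ^ 2 * B v.2 v.2 < 1 := hv
    have hnn : 0 ≤ f p.1 ^ 2 * B v.2 v.2 := mul_nonneg (sq_nonneg _) (hBnn _)
    refine max_le_max ?_ ?_
    · exact abs_le.2 ⟨by nlinarith, by nlinarith⟩
    · have := hC (f p.1 • v.2) (by
        simp only [Set.mem_ofPred_eq, map_smul, smul_apply, smul_eq_mul]
        nlinarith [mul_self_nonneg v.1])
      rw [norm_smul, Real.norm_of_nonneg hf0.le] at this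
      rw [le_div_iff₀ hf0]
      linarith
  contMDiff := by
    intro p
    refine contMDiffAt_hom_of_forall (F := (ℝ × E) →L[ℝ] ℝ)
      (V := fun p : S × N => TangentSpace (𝓘(ℝ, ℝ).prod 𝓘(ℝ, E)) p →L[ℝ] ℝ) _ fun v hv => ?_
    refine contMDiffAt_hom_of_forall (F := ℝ)
      (V := fun _ : S × N => ℝ) _ fun w hw => ?_
    rw [contMDiffAt_section]
    have hf' : ContMDiffAt (𝓘(ℝ, ℝ).prod 𝓘(ℝ, E)) 𝓘(ℝ, ℝ) ∞ (fun q : S × N => f q.1) p :=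
      hf.contMDiff.contMDiffAt.comp p (contMDiff_subtype_val.contMDiffAt.comp p contMDiffAt_fst)
    have hg : ContMDiffAt (𝓘(ℝ, ℝ).prod 𝓘(ℝ, E)) 𝓘(ℝ, ℝ) ∞
        (fun q : S × N => g.inner q.2 (v q).2 (w q).2) p := by
      have h1 := ContMDiffAt.clm_bundle_apply₂ (F₁ := E) (F₂ := E) (F₃ := ℝ)
        (E₃ := fun _ : N => ℝ) (b := fun q : S × N => q.2)
        (g.contMDiff.contMDiffAt.comp p contMDiffAt_snd)
        (contMDiffAt_snd_vec hv) (contMDiffAt_snd_vec hw)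
      exact (contMDiffAt_totalSpace.1 h1).2
    exact ((contMDiffAt_fst_vec hv).mul (contMDiffAt_fst_vec hw)).add ((hf'.pow 2).mul hg)

theorem contDiff_trig (α β : ℝ) :
    ContDiff ℝ ∞ (fun θ : ℝ => α * Real.cos θ + β * Real.sin θ) := by
  fun_prop

/-- The almost contact metric structure on the warped product `S ×_f N` of an open set `S` of real
numbers and an almost Hermitian manifold `N`: the metric is `dθ² + f(θ)² g`, and
`φ (a, X) = (0, J X)`, `ξ = ∂/∂θ`, `η = dθ`. -/
def warpedProduct (f : ℝ → ℝ) (hf : ContDiff ℝ ∞ f) (hpos : ∀ θ ∈ S, 0 < f θ)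
    (h : AlmostHermitian 𝓘(ℝ, E) N) : AlmostContactMetric (𝓘(ℝ, ℝ).prod 𝓘(ℝ, E)) (S × N) where
  g := warpedMetric f hf hpos h.g
  φ p :=
    let J : E →L[ℝ] E := h.J p.2
    (ContinuousLinearMap.inr ℝ ℝ E).comp (J.comp (ContinuousLinearMap.snd ℝ ℝ E))
  ξ _ := ((1, 0) : ℝ × E)
  η _ := ContinuousLinearMap.fst ℝ ℝ E
  contMDiff_φ p := by
    refine contMDiffAt_hom_of_forall (F := ℝ × E)
      (V := (TangentSpace (𝓘(ℝ, ℝ).prod 𝓘(ℝ, E)) : S × N → Type _)) _ fun v hv => ?_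
    refine contMDiffAt_mk_vec (a := fun _ => 0) (u := fun q => h.J q.2 (v q).2) ?_ ?_
    · exact (contMDiff_zeroSection ℝ (TangentSpace 𝓘(ℝ, ℝ) : S → Type _)).contMDiffAt.comp p
        contMDiffAt_fst
    · exact ContMDiffAt.clm_bundle_apply (F₁ := E) (F₂ := E) (b := fun q : S × N => q.2)
        (h.contMDiff_J.contMDiffAt.comp p contMDiffAt_snd) (contMDiffAt_snd_vec hv)
  contMDiff_ξ p := by
    refine contMDiffAt_mk_vec (a := fun _ => (1 : ℝ)) (u := fun q => 0) ?_ ?_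
    · exact (contMDiff_dθ S).contMDiffAt.comp p contMDiffAt_fst
    · exact (contMDiff_zeroSection ℝ (TangentSpace 𝓘(ℝ, E) : N → Type _)).contMDiffAt.comp p
        contMDiffAt_snd
  contMDiff_η p := by
    refine contMDiffAt_hom_of_forall (F := ℝ) (V := fun _ : S × N => ℝ) _ fun v hv => ?_
    rw [contMDiffAt_section]
    exact contMDiffAt_fst_vec hv
  φ_φ p u := by
    have h2 := h.J_J p.2 u.2
    refine Prod.ext ?_ ?_
    · change (0 : ℝ) = -u.1 + u.1 * 1
      ring
    · change h.J p.2 (h.J p.2 u.2) = -u.2 + (u.1 : ℝ) • (0 : E)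
      rw [h2, smul_zero]
      exact (add_zero (-(u.2 : E))).symm
  η_ξ p := rfl
  g_φ_φ p u v := by
    have h2 := h.g_J_J p.2 u.2 v.2
    change (0 : ℝ) * 0 + f p.1 ^ 2 * h.g.inner p.2 (h.J p.2 u.2) (h.J p.2 v.2)
      = ((u.1 : ℝ) * v.1 + f p.1 ^ 2 * h.g.inner p.2 u.2 v.2) - u.1 * v.1
    rw [h2]
    ring

end Product
end GrayCurvature

/-! For any positive warping function `f` the curvature of `dθ² + f² ḡ` is a sum of three pieces:
`f²` times the curvature of `N`; a multiple, with coefficient `f² f'²`, of the constant-curvature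
tensor built from `ḡ`; and mixed terms in `η`, with coefficient `f f''` (`riemann_warpedMetric`).
The trigonometric `f` enters only through `f'' = -f`, which makes the mixed coefficient a multiple
of `f²`. The mixed terms then match the correction terms `g ⊗ η ⊗ η` of G2 and G3. The
constant-curvature tensor satisfies the corresponding J-identities, because `J` is orthogonal and
skew-adjoint, so it drops out. What remains is `f²` times the Gray identity on `N`, and `f² > 0` can
be cancelled.

G2 has `φ` in the fourth slot where K2 has `J` in the first. `AlmostHermitian.isK2_iff` reconciles
the two by reversing the order of the arguments of the curvature tensor.

The curvature itself is computed in a chart. `IsLocalMetric.apply_curvatureOp_const` expresses it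
through second derivatives of the metric and products of Christoffel symbols,
`apply_curvatureOp_warpedChart` evaluates that for a warped product, and
`metricInChart_warpedMetric` shows that the product chart turns the warped metric into exactly this
coordinate form. -/

namespace GrayCurvature

/-! ### Riemannian metrics on open parts of a vector space: Christoffel symbols and curvature. -/

section LocalMetric

variable {E : Type*} [NormedAddCommGroup E] [NormedSpace ℝ E]
  {G : E → E →L[ℝ] E →L[ℝ] ℝ} {y : E}

theorem differentiableAt_of_forall_apply {F : Type*} [NormedAddCommGroup F] [NormedSpace ℝ F]
    [FiniteDimensional ℝ E] {f : F → E →L[ℝ] ℝ} {x : F}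
    (hf : ∀ w, DifferentiableAt ℝ (fun q => f q w) x) : DifferentiableAt ℝ f x := by
  let b := Module.finBasis ℝ E
  have h1 : f = fun q => ∑ i, f q (b i) • LinearMap.toContinuousLinearMap (b.coord i) := by
    ext q w
    conv_lhs => rw [← b.sum_repr w]
    simp only [map_sum, map_smul, smul_eq_mul, sum_apply]
    exact Finset.sum_congr rfl fun i _ => mul_comm _ _
  rw [h1]
  exact DifferentiableAt.fun_sum fun i _ => (hf (b i)).smul_const _

theorem contDiffAt_of_forall_apply {F F' : Type*} [NormedAddCommGroup F] [NormedSpace ℝ F]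
    [NormedAddCommGroup F'] [NormedSpace ℝ F'] [FiniteDimensional ℝ E] {n : WithTop ℕ∞}
    {f : F → E →L[ℝ] F'} {x : F}
    (hf : ∀ w, ContDiffAt ℝ n (fun q => f q w) x) : ContDiffAt ℝ n f x := by
  let b := Module.finBasis ℝ E
  have h1 : f = fun q => ∑ i, ContinuousLinearMap.smulRightL ℝ E F'
      (LinearMap.toContinuousLinearMap (b.coord i)) (f q (b i)) := by
    ext q w
    have h2 : f q w = ∑ i, b.repr w i • f q (b i) := by
      conv_lhs => rw [← b.sum_repr w]
      simp only [map_sum, map_smul]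
    simpa [sum_apply] using h2
  rw [h1]
  exact ContDiffAt.sum fun i _ =>
    (ContinuousLinearMap.contDiff _).contDiffAt.comp x (hf (b i))

/-- `G` is a Riemannian metric of class `C²` near the point `y` of a vector space. -/
structure IsLocalMetric (G : E → E →L[ℝ] E →L[ℝ] ℝ) (y : E) : Prop where
  contDiffAt : ContDiffAt ℝ 2 G y
  symm : ∀ᶠ q in 𝓝 y, ∀ u v, G q u v = G q v u
  pos : ∀ᶠ q in 𝓝 y, ∀ u, u ≠ 0 → 0 < G q u u

/-- The second derivative, in the directions `u` and `x`, of the component `G (v, w)`. -/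
def metricHess (G : E → E →L[ℝ] E →L[ℝ] ℝ) (y u x v w : E) : ℝ :=
  fderiv ℝ (fderiv ℝ fun q => G q v w) y u x

namespace IsLocalMetric

/-- Pointwise identities for local metrics thereby hold on a neighbourhood, and so can be
differentiated. -/
theorem eventually (h : IsLocalMetric G y) : ∀ᶠ q in 𝓝 y, IsLocalMetric G q := by
  filter_upwards [h.contDiffAt.eventually (by simp), eventually_eventually_nhds.2 h.symm,
    eventually_eventually_nhds.2 h.pos] with q h1 h2 h3
  exact ⟨h1, h2, h3⟩

theorem differentiableAt (h : IsLocalMetric G y) : DifferentiableAt ℝ G y :=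
  h.contDiffAt.differentiableAt (by simp)

theorem apply_symm (h : IsLocalMetric G y) (u v : E) : G y u v = G y v u :=
  h.symm.self_of_nhds u v

theorem ext (h : IsLocalMetric G y) {u v : E} (huv : ∀ w, G y u w = G y v w) : u = v := by
  by_contra hne
  have h1 := h.pos.self_of_nhds (u - v) (sub_ne_zero.2 hne)
  have h2 : G y (u - v) = 0 := by
    rw [map_sub, sub_eq_zero]
    exact ContinuousLinearMap.ext huv
  rw [h2] at h1
  exact lt_irrefl _ h1

/-- The derivative of the components of a metric in constant directions. -/
theorem hasFDerivAt_apply (h : IsLocalMetric G y) (v w : E) :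
    HasFDerivAt (fun q => G q v w) (((fderiv ℝ G y).flip v).flip w) y := by
  have h1 := (h.differentiableAt.hasFDerivAt.clm_apply (hasFDerivAt_const v y)).clm_apply
    (hasFDerivAt_const w y)
  refine h1.congr_fderiv ?_
  ext u
  simp

theorem fderiv_apply (h : IsLocalMetric G y) (u v w : E) :
    fderiv ℝ (fun q => G q v w) y u = fderiv ℝ G y u v w := by
  rw [(h.hasFDerivAt_apply v w).fderiv]
  rfl

theorem contDiffAt_apply (h : IsLocalMetric G y) (v w : E) :
    ContDiffAt ℝ 2 (fun q => G q v w) y :=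
  (h.contDiffAt.clm_apply contDiffAt_const).clm_apply contDiffAt_const

theorem hasFDerivAt_fderiv_apply (h : IsLocalMetric G y) (x v w : E) :
    HasFDerivAt (fun q => fderiv ℝ G q x v w)
      ((fderiv ℝ (fderiv ℝ fun q => G q v w) y).flip x) y := by
  have h1 : DifferentiableAt ℝ (fderiv ℝ fun q => G q v w) y :=
    ((h.contDiffAt_apply v w).fderiv_right (m := 1) (by norm_num)).differentiableAt (by simp)
  have h2 := h1.hasFDerivAt.clm_apply (hasFDerivAt_const x y)
  have h3 : (fun q => fderiv ℝ G q x v w) =ᶠ[𝓝 y] fun q => fderiv ℝ (fun q => G q v w) q x := by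
    filter_upwards [h.eventually] with q hq using (hq.fderiv_apply x v w).symm
  refine (h2.congr_of_eventuallyEq h3).congr_fderiv ?_
  ext u
  simp

theorem fderiv_symm (h : IsLocalMetric G y) (u v w : E) :
    fderiv ℝ G y u v w = fderiv ℝ G y u w v := by
  rw [← h.fderiv_apply, ← h.fderiv_apply]
  have : (fun q => G q v w) =ᶠ[𝓝 y] fun q => G q w v := by
    filter_upwards [h.symm] with q hq using hq v w
  rw [this.fderiv_eq]

theorem metricHess_symm (h : IsLocalMetric G y) (u x v w : E) :
    metricHess G y u x v w = metricHess G y u x w v := by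
  have : (fun q => G q v w) =ᶠ[𝓝 y] fun q => G q w v := by
    filter_upwards [h.symm] with q hq using hq v w
  rw [metricHess, metricHess, this.fderiv.fderiv_eq]

theorem metricHess_comm (h : IsLocalMetric G y) (u x v w : E) :
    metricHess G y u x v w = metricHess G y x u v w :=
  (h.contDiffAt_apply v w).isSymmSndFDerivAt (by simp) u x

variable [FiniteDimensional ℝ E]

/-- Positivity gives injectivity, and `E` and its dual have the same finite dimension. Hence
`inverse` in `christoffel` is the true inverse and not the default value zero. -/
theorem isInvertible (h : IsLocalMetric G y) : (G y).IsInvertible := by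
  have hinj : Function.Injective (G y) := fun u v huv => h.ext fun w => by rw [huv]
  let L : E →ₗ[ℝ] (E →L[ℝ] ℝ) := G y
  have hfr : Module.finrank ℝ E = Module.finrank ℝ (E →L[ℝ] ℝ) := by
    rw [← Subspace.dual_finrank_eq (K := ℝ) (V := E)]
    exact (LinearMap.toContinuousLinearMap (𝕜 := ℝ) (E := E) (F' := ℝ)).finrank_eq
  let e := (LinearEquiv.ofInjectiveOfFinrankEq L hinj hfr).toContinuousLinearEquiv
  exact ⟨e, by ext u w; rfl⟩

theorem apply_christoffel (h : IsLocalMetric G y) (u v w : E) :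
    G y (christoffel G y u v) w =
      1 / 2 * (fderiv ℝ G y u v w + fderiv ℝ G y v u w - fderiv ℝ G y w u v) := by
  rw [christoffel, h.isInvertible.self_apply_inverse]
  rfl

theorem christoffel_eq (h : IsLocalMetric G y) {u v x : E}
    (hx : ∀ w, G y x w =
      1 / 2 * (fderiv ℝ G y u v w + fderiv ℝ G y v u w - fderiv ℝ G y w u v)) :
    christoffel G y u v = x :=
  h.ext fun w => by rw [h.apply_christoffel, hx]

theorem christoffel_symm (h : IsLocalMetric G y) (u v : E) :
    christoffel G y u v = christoffel G y v u :=
  h.christoffel_eq fun w => by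
    rw [h.apply_christoffel, h.fderiv_symm w u v]
    ring

theorem christoffel_zero_left (h : IsLocalMetric G y) (v : E) : christoffel G y 0 v = 0 :=
  h.christoffel_eq fun w => by
    rw [← h.fderiv_apply, ← h.fderiv_apply, ← h.fderiv_apply]
    simp

/-- Compatibility of the Levi-Civita connection with the metric, `∇G = 0`. -/
theorem fderiv_eq_christoffel (h : IsLocalMetric G y) (u v w : E) :
    fderiv ℝ G y u v w = G y (christoffel G y u v) w + G y (christoffel G y u w) v := by
  rw [h.apply_christoffel, h.apply_christoffel, h.fderiv_symm u w v, h.fderiv_symm w u v]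
  ring

theorem differentiableAt_christoffel (h : IsLocalMetric G y) (u v : E) :
    DifferentiableAt ℝ (fun q => christoffel G q u v) y := by
  have h1 : DifferentiableAt ℝ (fun q => (G q).inverse) y :=
    ((h.isInvertible.contDiffAt_map_inverse (n := 1)).differentiableAt (by simp)).comp y
      h.differentiableAt
  refine h1.clm_apply (differentiableAt_of_forall_apply fun w => ?_)
  exact (((h.hasFDerivAt_fderiv_apply u v w).add (h.hasFDerivAt_fderiv_apply v u w)).sub
    (h.hasFDerivAt_fderiv_apply w u v)).differentiableAt.const_mul (1 / 2 : ℝ)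

/-- Differentiating the defining identity of `G (Γ, w)` by the product rule avoids computing the
derivative of the inverse metric; only its differentiability is needed. -/
theorem apply_fderiv_christoffel (h : IsLocalMetric G y) (x u v w : E) :
    G y (fderiv ℝ (fun q => christoffel G q u v) y x) w =
      1 / 2 * (metricHess G y x u v w + metricHess G y x v u w
        - metricHess G y x w u v) - fderiv ℝ G y x (christoffel G y u v) w := by
  have h1 := (h.differentiableAt.hasFDerivAt.clm_apply
    (h.differentiableAt_christoffel u v).hasFDerivAt).clm_apply (hasFDerivAt_const w y)
  have h2 := (((h.hasFDerivAt_fderiv_apply u v w).add (h.hasFDerivAt_fderiv_apply v u w)).sub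
    (h.hasFDerivAt_fderiv_apply w u v)).const_mul (1 / 2 : ℝ)
  have h3 : (fun q => G q (christoffel G q u v) w) =ᶠ[𝓝 y] fun q =>
      1 / 2 * (fderiv ℝ G q u v w + fderiv ℝ G q v u w - fderiv ℝ G q w u v) := by
    filter_upwards [h.eventually] with q hq using hq.apply_christoffel u v w
  have h4 := DFunLike.congr_fun (h1.unique (h2.congr_of_eventuallyEq h3)) x
  simp at h4
  simp only [metricHess]
  linarith

/-- The curvature of a metric, applied to constant vector fields, in terms of the second
derivatives of the metric and its Christoffel symbols. -/
theorem apply_curvatureOp_const (h : IsLocalMetric G y) (u v w z : E) :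
    G y (curvatureOp G (fun _ => u) (fun _ => v) (fun _ => w) y) z =
      1 / 2 * (metricHess G y u w v z - metricHess G y u z v w
        - metricHess G y v w u z + metricHess G y v z u w)
      - G y (christoffel G y u z) (christoffel G y v w)
      + G y (christoffel G y v z) (christoffel G y u w) := by
  have h0 : ∀ a b : E, covDeriv G (fun _ => a) (fun _ => b) = fun q => christoffel G q a b := by
    intro a b
    ext q
    simp [covDeriv]
  have h1 : curvatureOp G (fun _ => u) (fun _ => v) (fun _ => w) y =
      (fderiv ℝ (fun q => christoffel G q v w) y u
        + christoffel G y u (christoffel G y v w))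
      - (fderiv ℝ (fun q => christoffel G q u w) y v
        + christoffel G y v (christoffel G y u w)) := by
    rw [curvatureOp, h0, h0]
    simp [covDeriv, VectorField.lieBracket, h.christoffel_zero_left]
  -- By metric compatibility the first term here cancels the `Γ(Γ)` terms of the curvature, leaving
  -- only inner products of two Christoffel symbols.
  have h2 : ∀ a b c : E, fderiv ℝ G y a (christoffel G y b c) z =
      G y (christoffel G y a (christoffel G y b c)) z
        + G y (christoffel G y a z) (christoffel G y b c) := fun a b c =>
    h.fderiv_eq_christoffel _ _ _
  have h3 : ∀ a b c d : E, G y ((a + b) - (c + d)) z = G y a z + G y b z - (G y c z + G y d z) :=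
    fun a b c d => by
      rw [(G y).map_sub, (G y).map_add, (G y).map_add]; rfl
  rw [h1, h3,
    h.apply_fderiv_christoffel, h.apply_fderiv_christoffel, h2, h2,
    h.metricHess_comm u v]
  ring

/-- Pair symmetry combined with both skew symmetries. It can be read off the coordinate formula,
since `Γ`, `G` and the second derivatives are symmetric. -/
theorem apply_curvatureOp_const_pair_symm (h : IsLocalMetric G y) (u v w z : E) :
    G y (curvatureOp G (fun _ => z) (fun _ => w) (fun _ => v) y) u =
      G y (curvatureOp G (fun _ => u) (fun _ => v) (fun _ => w) y) z := by
  rw [h.apply_curvatureOp_const, h.apply_curvatureOp_const, h.christoffel_symm z u,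
    h.christoffel_symm w v, h.christoffel_symm w u, h.christoffel_symm z v,
    h.apply_symm (christoffel G y u w), h.metricHess_comm z v, h.metricHess_comm z u,
    h.metricHess_comm w v, h.metricHess_comm w u, h.metricHess_symm v z w,
    h.metricHess_symm u z w, h.metricHess_symm v w z, h.metricHess_symm u w z]
  ring

end IsLocalMetric

end LocalMetric

/-! ### Warped products in coordinates. -/

section WarpedChart

variable {E : Type*} [NormedAddCommGroup E] [NormedSpace ℝ E]

/-- The warped product metric `dθ² + f(θ)² G` on an open part of `ℝ × E`. -/
def warpedChart (f : ℝ → ℝ) (G : E → E →L[ℝ] E →L[ℝ] ℝ) (q : ℝ × E) :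
    ℝ × E →L[ℝ] ℝ × E →L[ℝ] ℝ :=
  (ContinuousLinearMap.mul ℝ ℝ).bilinearComp (ContinuousLinearMap.fst ℝ ℝ E)
      (ContinuousLinearMap.fst ℝ ℝ E)
    + (f q.1) ^ 2 • (G q.2).bilinearComp (ContinuousLinearMap.snd ℝ ℝ E)
      (ContinuousLinearMap.snd ℝ ℝ E)

theorem warpedChart_apply (f : ℝ → ℝ) (G : E → E →L[ℝ] E →L[ℝ] ℝ) (q v w : ℝ × E) :
    warpedChart f G q v w = v.1 * w.1 + f q.1 ^ 2 * G q.2 v.2 w.2 := rfl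

variable [FiniteDimensional ℝ E] {f : ℝ → ℝ} {G : E → E →L[ℝ] E →L[ℝ] ℝ} {y : ℝ × E}

theorem IsLocalMetric.warpedChart (h : IsLocalMetric G y.2) (hf : ContDiff ℝ ∞ f)
    (hpos : 0 < f y.1) : IsLocalMetric (warpedChart f G) y where
  contDiffAt := by
    refine contDiffAt_of_forall_apply fun v => contDiffAt_of_forall_apply fun w => ?_
    have h1 : ContDiffAt ℝ 2 (fun q : ℝ × E => f q.1) y :=
      (contDiff_infty.1 hf 2).contDiffAt.comp y contDiffAt_fst
    have h2 : ContDiffAt ℝ 2 (fun q : ℝ × E => G q.2 v.2 w.2) y :=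
      (h.contDiffAt_apply v.2 w.2).comp y contDiffAt_snd
    exact contDiffAt_const.add ((h1.pow 2).mul h2)
  symm := by
    filter_upwards [continuousAt_snd.eventually h.symm] with q hq u v
    rw [warpedChart_apply, warpedChart_apply, hq, mul_comm u.1]
  pos := by
    have h1 : ∀ᶠ q : ℝ × E in 𝓝 y, 0 < f q.1 :=
      (hf.continuous.comp continuous_fst).continuousAt.eventually (lt_mem_nhds hpos)
    filter_upwards [continuousAt_snd.eventually h.pos, h1] with q hq hq1 u hu
    rw [warpedChart_apply]
    by_cases h2 : u.2 = 0
    · have h3 : u.1 ≠ 0 := fun h3 => hu (Prod.ext h3 h2)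
      rw [h2, map_zero, mul_zero, add_zero]
      exact mul_self_pos.2 h3
    · have := mul_pos (pow_pos hq1 2) (hq u.2 h2)
      nlinarith [mul_self_nonneg u.1]

theorem fderiv_warpedChart (h : IsLocalMetric G y.2) (hf : ContDiff ℝ ∞ f) (hpos : 0 < f y.1)
    (u v w : ℝ × E) :
    fderiv ℝ (warpedChart f G) y u v w =
      2 * (f y.1 * deriv f y.1) * u.1 * G y.2 v.2 w.2
        + f y.1 ^ 2 * fderiv ℝ G y.2 u.2 v.2 w.2 := by
  rw [← (h.warpedChart hf hpos).fderiv_apply]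
  have h1 : HasFDerivAt (fun q : ℝ × E => f q.1)
      (deriv f y.1 • ContinuousLinearMap.fst ℝ ℝ E) y :=
    ((hf.differentiable (by simp)) y.1).hasDerivAt.comp_hasFDerivAt y hasFDerivAt_fst
  have h2 := (h.hasFDerivAt_apply v.2 w.2).comp y hasFDerivAt_snd
  have h3 := ((h1.pow 2).mul h2).const_add (v.1 * w.1)
  rw [HasFDerivAt.fderiv (f := fun q => GrayCurvature.warpedChart f G q v w) h3]
  simp
  ring

theorem metricHess_warpedChart (h : IsLocalMetric G y.2) (hf : ContDiff ℝ ∞ f)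
    (hpos : 0 < f y.1) (u x v w : ℝ × E) :
    metricHess (warpedChart f G) y u x v w =
      2 * (deriv f y.1 ^ 2 + f y.1 * deriv (deriv f) y.1) * u.1 * x.1 * G y.2 v.2 w.2
        + 2 * (f y.1 * deriv f y.1) * x.1 * fderiv ℝ G y.2 u.2 v.2 w.2
        + 2 * (f y.1 * deriv f y.1) * u.1 * fderiv ℝ G y.2 x.2 v.2 w.2
        + f y.1 ^ 2 * metricHess G y.2 u.2 x.2 v.2 w.2 := by
  have hf' : ContDiff ℝ ∞ (deriv f) := ((contDiff_infty_iff_deriv (𝕜 := ℝ)).1 hf).2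
  have h0 := DFunLike.congr_fun ((h.warpedChart hf hpos).hasFDerivAt_fderiv_apply x v w).fderiv u
  have h1 : HasFDerivAt (fun q : ℝ × E => f q.1)
      (deriv f y.1 • ContinuousLinearMap.fst ℝ ℝ E) y :=
    ((hf.differentiable (by simp)) y.1).hasDerivAt.comp_hasFDerivAt y hasFDerivAt_fst
  have h2 : HasFDerivAt (fun q : ℝ × E => deriv f q.1)
      (deriv (deriv f) y.1 • ContinuousLinearMap.fst ℝ ℝ E) y :=
    ((hf'.differentiable (by simp)) y.1).hasDerivAt.comp_hasFDerivAt y hasFDerivAt_fst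
  have h3 := (h.hasFDerivAt_apply v.2 w.2).comp y hasFDerivAt_snd
  have h4 := (h.hasFDerivAt_fderiv_apply x.2 v.2 w.2).comp y hasFDerivAt_snd
  have h5 := ((((h1.mul h2).const_mul 2).mul_const x.1).mul h3).add ((h1.pow 2).mul h4)
  have hev : (fun q => fderiv ℝ (GrayCurvature.warpedChart f G) q x v w) =ᶠ[𝓝 y] fun q =>
      2 * (f q.1 * deriv f q.1) * x.1 * G q.2 v.2 w.2
        + f q.1 ^ 2 * fderiv ℝ G q.2 x.2 v.2 w.2 := by
    have h1 : ∀ᶠ q : ℝ × E in 𝓝 y, 0 < f q.1 :=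
      (hf.continuous.comp continuous_fst).continuousAt.eventually (lt_mem_nhds hpos)
    filter_upwards [continuousAt_snd.eventually h.eventually, h1] with q hq hq1
      using fderiv_warpedChart hq hf hq1 x v w
  have h6 := DFunLike.congr_fun (HasFDerivAt.fderiv (h5.congr_of_eventuallyEq hev)) u
  refine (h0.symm.trans h6).trans ?_
  simp [metricHess]
  ring

/-- It suffices to check the candidate against the defining identity, since the metric is
nondegenerate. -/
theorem christoffel_warpedChart (h : IsLocalMetric G y.2) (hf : ContDiff ℝ ∞ f)
    (hpos : 0 < f y.1) (u v : ℝ × E) :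
    christoffel (warpedChart f G) y u v =
      (-(f y.1 * deriv f y.1) * G y.2 u.2 v.2,
        christoffel G y.2 u.2 v.2 + (deriv f y.1 / f y.1) • (u.1 • v.2 + v.1 • u.2)) := by
  refine (h.warpedChart hf hpos).christoffel_eq fun w => ?_
  rw [fderiv_warpedChart h hf hpos, fderiv_warpedChart h hf hpos, fderiv_warpedChart h hf hpos,
    warpedChart_apply]
  simp only [map_add, map_smul, add_apply, smul_apply, smul_eq_mul, h.apply_christoffel]
  field_simp
  ring

/-- The curvature of a warped product metric over an interval. -/
theorem apply_curvatureOp_warpedChart (h : IsLocalMetric G y.2) (hf : ContDiff ℝ ∞ f)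
    (hpos : 0 < f y.1) (u v w z : ℝ × E) :
    warpedChart f G y (curvatureOp (warpedChart f G) (fun _ => u) (fun _ => v) (fun _ => w) y) z =
      f y.1 ^ 2 * G y.2 (curvatureOp G (fun _ => u.2) (fun _ => v.2) (fun _ => w.2) y.2) z.2
      + f y.1 ^ 2 * deriv f y.1 ^ 2 *
        (G y.2 u.2 w.2 * G y.2 v.2 z.2 - G y.2 u.2 z.2 * G y.2 v.2 w.2)
      + f y.1 * deriv (deriv f) y.1 *
        (u.1 * w.1 * G y.2 v.2 z.2 - u.1 * z.1 * G y.2 v.2 w.2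
          - v.1 * w.1 * G y.2 u.2 z.2 + v.1 * z.1 * G y.2 u.2 w.2) := by
  rw [(h.warpedChart hf hpos).apply_curvatureOp_const, h.apply_curvatureOp_const]
  simp only [metricHess_warpedChart h hf hpos, christoffel_warpedChart h hf hpos,
    warpedChart_apply, h.fderiv_eq_christoffel]
  simp only [map_add, map_smul, add_apply, smul_apply, smul_eq_mul]
  -- Writing `f' = k f` with `k = f'/f` removes all division, so that after the symmetric terms are
  -- put in a common order a polynomial identity remains.
  have hk : deriv f y.1 = deriv f y.1 / f y.1 * f y.1 := by field_simp
  generalize deriv f y.1 / f y.1 = k at *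
  rw [hk]
  rw [h.apply_symm u.2 (christoffel G y.2 v.2 w.2), h.apply_symm v.2 (christoffel G y.2 u.2 w.2),
    h.apply_symm z.2 (christoffel G y.2 v.2 w.2), h.apply_symm z.2 (christoffel G y.2 u.2 w.2),
    h.christoffel_symm z.2 u.2, h.christoffel_symm z.2 v.2, h.christoffel_symm w.2 u.2,
    h.christoffel_symm w.2 v.2, h.christoffel_symm v.2 u.2,
    h.christoffel_symm z.2 w.2, h.apply_symm z.2 u.2, h.apply_symm z.2 v.2, h.apply_symm v.2 u.2]
  ring

end WarpedChart

/-! ### Passing from a manifold to its charts. -/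

section ManifoldChart

variable {E : Type*} [NormedAddCommGroup E] [NormedSpace ℝ E]
  {H : Type*} [TopologicalSpace H] {I : ModelWithCorners ℝ E H} [I.Boundaryless]
  {M : Type*} [TopologicalSpace M] [ChartedSpace H M] [IsManifold I ∞ M]

/-- Links the chart components of a metric to the tangent bundle trivialization, through which
smoothness and injectivity are available. Without boundary, derivatives within the range of `I` are
ordinary ones. -/
theorem mfderiv_extChartAt_symm_eq_symmL (p : M) {y : E} (hy : y ∈ (extChartAt I p).target) :
    mfderiv 𝓘(ℝ, E) I (extChartAt I p).symm y =
      (trivializationAt E (TangentSpace I : M → Type _) p).symmL ℝ ((extChartAt I p).symm y) := by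
  have hx : (extChartAt I p).symm y ∈ (chartAt H p).source := by
    rw [← extChartAt_source I]
    exact (extChartAt I p).map_target hy
  have : IsManifold I 1 M := IsManifold.of_le (n := ∞) (by simp)
  rw [TangentBundle.symmL_trivializationAt hx, (extChartAt I p).right_inv hy, I.range_eq_univ,
    mfderivWithin_univ]

theorem metricInChart_apply (g : Metric I M) (p : M) {y : E}
    (hy : y ∈ (extChartAt I p).target) (u v : E) :
    metricInChart g p y u v = g.inner ((extChartAt I p).symm y)
      ((trivializationAt E (TangentSpace I : M → Type _) p).symmL ℝ ((extChartAt I p).symm y) u)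
      ((trivializationAt E (TangentSpace I : M → Type _) p).symmL ℝ
        ((extChartAt I p).symm y) v) := by
  rw [← mfderiv_extChartAt_symm_eq_symmL p hy]
  rfl

theorem contDiffAt_metricInChart_apply (g : Metric I M) (p : M) {y : E}
    (hy : y ∈ (extChartAt I p).target) (u v : E) :
    ContDiffAt ℝ ∞ (fun q => metricInChart g p q u v) y := by
  -- The coordinate vector fields of the chart at `p` are smooth on its whole domain.
  have hs : ∀ e : E, ContMDiffAt I (I.prod 𝓘(ℝ, E)) ∞
      (fun x => TotalSpace.mk' E (E := (TangentSpace I : M → Type _)) x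
        ((trivializationAt E (TangentSpace I : M → Type _) p).symmL ℝ x e))
      ((extChartAt I p).symm y) := by
    intro e
    have h1 := (trivializationAt E (TangentSpace I : M → Type _) p).contMDiffAt_symmL
      (IB := I) (n := ∞) (x := (extChartAt I p).symm y) (by
        rw [TangentBundle.trivializationAt_baseSet, ← extChartAt_source I]
        exact (extChartAt I p).map_target hy)
    have h2 : ContMDiffAt I (I.prod 𝓘(ℝ, E)) ∞
        (fun x => TotalSpace.mk' E (E := Bundle.Trivial M E) x e) ((extChartAt I p).symm y) := by
      rw [contMDiffAt_section]
      exact contMDiffAt_const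
    exact ContMDiffAt.clm_bundle_apply (F₁ := E) (F₂ := E) (b := fun x => x) h1 h2
  have h1 := ContMDiffAt.clm_bundle_apply₂ (F₁ := E) (F₂ := E) (F₃ := ℝ)
    (E₃ := fun _ : M => ℝ) (b := fun x : M => x) g.contMDiff.contMDiffAt (hs u) (hs v)
  have h2 := (contMDiffAt_totalSpace.1 h1).2
  have h3 : ContMDiffAt 𝓘(ℝ, E) I ∞ (extChartAt I p).symm y :=
    (contMDiffOn_extChartAt_symm p).contMDiffAt
      ((isOpen_extChartAt_target (I := I) p).mem_nhds hy)
  refine (h2.comp y h3).contDiffAt.congr_of_eventuallyEq ?_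
  filter_upwards [(isOpen_extChartAt_target (I := I) p).mem_nhds hy] with q hq
  exact metricInChart_apply g p hq u v

theorem isLocalMetric_metricInChart [FiniteDimensional ℝ E] (g : Metric I M) (p : M) {y : E}
    (hy : y ∈ (extChartAt I p).target) : IsLocalMetric (metricInChart g p) y where
  contDiffAt := contDiffAt_of_forall_apply fun u => contDiffAt_of_forall_apply fun v =>
    contDiffAt_infty.1 (contDiffAt_metricInChart_apply g p hy u v) 2
  symm := by
    filter_upwards [(isOpen_extChartAt_target (I := I) p).mem_nhds hy] with q hq u v
    rw [metricInChart_apply g p hq, metricInChart_apply g p hq, g.symm]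
  pos := by
    filter_upwards [(isOpen_extChartAt_target (I := I) p).mem_nhds hy] with q hq u hu
    rw [metricInChart_apply g p hq]
    refine g.pos _ _ fun h0 => hu ?_
    have hb : (extChartAt I p).symm q ∈
        (trivializationAt E (TangentSpace I : M → Type _) p).baseSet := by
      rw [TangentBundle.trivializationAt_baseSet, ← extChartAt_source I]
      exact (extChartAt I p).map_target hq
    have h1 := (trivializationAt E (TangentSpace I : M → Type _) p).continuousLinearMapAt_symmL
      (R := ℝ) hb u
    rw [← h1, h0, map_zero]

theorem mfderiv_extChartAt_symm_self (p : M) :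
    mfderiv 𝓘(ℝ, E) I (extChartAt I p).symm (extChartAt I p p) = ContinuousLinearMap.id ℝ E := by
  have : IsManifold I 1 M := IsManifold.of_le (n := ∞) (by simp)
  have h := mfderivWithin_range_extChartAt_symm (I := I) (x := p)
  rwa [I.range_eq_univ, mfderivWithin_univ] at h

theorem metricInChart_self (g : Metric I M) (p : M) (u v : E) :
    metricInChart g p (extChartAt I p p) u v = (g.inner p : E →L[ℝ] E →L[ℝ] ℝ) u v := by
  have h1 : metricInChart g p (extChartAt I p p) u v =
      (g.inner ((extChartAt I p).symm (extChartAt I p p)) : E →L[ℝ] E →L[ℝ] ℝ)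
        ((mfderiv 𝓘(ℝ, E) I (extChartAt I p).symm (extChartAt I p p) : E →L[ℝ] E) u)
        ((mfderiv 𝓘(ℝ, E) I (extChartAt I p).symm (extChartAt I p p) : E →L[ℝ] E) v) := rfl
  rw [h1, mfderiv_extChartAt_symm_self, extChartAt_to_inv]
  rfl

-- The derivative of the preferred chart at its own centre is the identity in the identification of
-- `TangentSpace I p` with `E`.
omit [I.Boundaryless] in
theorem riemann_eq (g : Metric I M) (p : M) (u v w z : E) :
    riemann g p u v w z =
      -metricInChart g p (extChartAt I p p) (curvatureOp (metricInChart g p)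
        (fun _ => u) (fun _ => v) (fun _ => w) (extChartAt I p p)) z := by
  have : IsManifold I 1 M := IsManifold.of_le (n := ∞) (by simp)
  have h := mfderiv_extChartAt_self (I := I) (x := p)
  unfold riemann
  simp only [h]
  rfl

theorem riemann_pair_symm [FiniteDimensional ℝ E] (g : Metric I M) (p : M)
    (u v w z : TangentSpace I p) : riemann g p z w v u = riemann g p u v w z := by
  have hp := isLocalMetric_metricInChart g p (mem_extChartAt_target p)
  have h := hp.apply_curvatureOp_const_pair_symm u v w z
  exact (riemann_eq g p z w v u).trans ((congrArg Neg.neg h).trans (riemann_eq g p u v w z).symm)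

end ManifoldChart

/-- Curvature depends only on the germ of the metric. This is needed because chart descriptions of a
metric agree only on the chart target. -/
theorem curvatureOp_congr {E : Type*} [NormedAddCommGroup E] [NormedSpace ℝ E]
    {G G' : E → E →L[ℝ] E →L[ℝ] ℝ} {y : E} (h : G =ᶠ[𝓝 y] G') (X Y Z : E → E) :
    curvatureOp G X Y Z y = curvatureOp G' X Y Z y := by
  have h1 : ∀ {q : E}, G =ᶠ[𝓝 q] G' → ∀ X Y : E → E,
      covDeriv G X Y q = covDeriv G' X Y q := fun hq X Y => by
    rw [covDeriv, covDeriv, christoffel, christoffel, hq.fderiv_eq, hq.eq_of_nhds]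
  have h2 : ∀ X Y : E → E, covDeriv G X Y =ᶠ[𝓝 y] covDeriv G' X Y := fun X Y => by
    filter_upwards [eventually_eventually_nhds.2 h] with q hq using h1 hq X Y
  have h3 : ∀ {A B : E → E}, A =ᶠ[𝓝 y] B → ∀ X : E → E,
      covDeriv G' X A y = covDeriv G' X B y := fun hAB X => by
    rw [covDeriv, covDeriv, hAB.fderiv_eq, hAB.eq_of_nhds]
  rw [curvatureOp, curvatureOp, h1 h, h1 h, h1 h, h3 (h2 Y Z), h3 (h2 X Z)]

/-! ### The curvature tensor of a warped product manifold. -/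

section Warped

variable {E : Type*} [NormedAddCommGroup E] [NormedSpace ℝ E]
  {N : Type*} [TopologicalSpace N] [ChartedSpace E N] [IsManifold 𝓘(ℝ, E) ∞ N]
  {S : TopologicalSpace.Opens ℝ}

theorem extChartAt_opens_apply (s t : S) : extChartAt 𝓘(ℝ, ℝ) s t = (t : ℝ) := by
  simp [extChartAt, TopologicalSpace.Opens.chartAt_eq, chartAt_self_eq]

/-- Following the inverse chart by the inclusion of `S` in `ℝ` gives the identity near `t`, and the
inclusion has derivative the identity. This holds throughout the target, not just at the centre. -/
theorem hasMFDerivAt_extChartAt_opens_symm (s : S) {t : ℝ}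
    (ht : t ∈ (extChartAt 𝓘(ℝ, ℝ) s).target) :
    HasMFDerivAt 𝓘(ℝ, ℝ) 𝓘(ℝ, ℝ) (extChartAt 𝓘(ℝ, ℝ) s).symm t (ContinuousLinearMap.id ℝ ℝ) := by
  have hnhds := (isOpen_extChartAt_target (I := 𝓘(ℝ, ℝ)) s).mem_nhds ht
  have h1 : MDifferentiableAt 𝓘(ℝ, ℝ) 𝓘(ℝ, ℝ) (extChartAt 𝓘(ℝ, ℝ) s).symm t :=
    (mdifferentiableOn_extChartAt_symm (x := s) t ht).mdifferentiableAt hnhds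
  have h2 := (mfderiv_coe_opens S ((extChartAt 𝓘(ℝ, ℝ) s).symm t)).comp t h1.hasMFDerivAt
  have h3 : HasMFDerivAt 𝓘(ℝ, ℝ) 𝓘(ℝ, ℝ) (fun t : ℝ => t) t (ContinuousLinearMap.id ℝ ℝ) :=
    hasMFDerivAt_id t
  have h4 : ((fun t : S => (t : ℝ)) ∘ (extChartAt 𝓘(ℝ, ℝ) s).symm) =ᶠ[𝓝 t] fun t => t := by
    filter_upwards [hnhds] with q hq
    have := (extChartAt 𝓘(ℝ, ℝ) s).right_inv hq
    rwa [extChartAt_opens_apply] at this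
  have h5 := hasMFDerivAt_unique h2 (h3.congr_of_eventuallyEq h4)
  have h6 := h1.hasMFDerivAt
  have h7 : mfderiv 𝓘(ℝ, ℝ) 𝓘(ℝ, ℝ) (extChartAt 𝓘(ℝ, ℝ) s).symm t =
      ContinuousLinearMap.id ℝ ℝ := (ContinuousLinearMap.id_comp _).symm.trans h5
  rwa [h7] at h6

variable [FiniteDimensional ℝ E]

/-- The inverse of the product chart has block-diagonal derivative, with the identity on the `ℝ`
factor, so pulling back commutes with warping. -/
theorem metricInChart_warpedMetric (f : ℝ → ℝ) (hf : ContDiff ℝ ∞ f)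
    (hpos : ∀ θ ∈ S, 0 < f θ) (g : Metric 𝓘(ℝ, E) N) (p : S × N) {y : ℝ × E}
    (hy : y ∈ (extChartAt (𝓘(ℝ, ℝ).prod 𝓘(ℝ, E)) p).target) :
    metricInChart (warpedMetric f hf hpos g) p y = warpedChart f (metricInChart g p.2) y := by
  rw [extChartAt_prod] at hy
  obtain ⟨hy1, hy2⟩ := hy
  have h1 := (hasMFDerivAt_extChartAt_opens_symm p.1 hy1).comp y
    (hasFDerivAt_fst (𝕜 := ℝ) (p := y)).hasMFDerivAt
  have h2 : MDifferentiableAt 𝓘(ℝ, E) 𝓘(ℝ, E) (extChartAt 𝓘(ℝ, E) p.2).symm y.2 := by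
    have : IsManifold 𝓘(ℝ, E) 1 N := IsManifold.of_le (n := ∞) (by simp)
    exact (mdifferentiableOn_extChartAt_symm (x := p.2) y.2 hy2).mdifferentiableAt
      ((isOpen_extChartAt_target (I := 𝓘(ℝ, E)) p.2).mem_nhds hy2)
  have h3 := h2.hasMFDerivAt.comp y (hasFDerivAt_snd (𝕜 := ℝ) (p := y)).hasMFDerivAt
  have h4 := (h1.prodMk h3).mfderiv
  -- The coordinate on `S` is `θ` itself, so the warping factor is evaluated at `y.1`.
  have h5 : (((extChartAt 𝓘(ℝ, ℝ) p.1).symm y.1 : S) : ℝ) = y.1 := by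
    have := (extChartAt 𝓘(ℝ, ℝ) p.1).right_inv hy1
    rwa [extChartAt_opens_apply] at this
  have h6 : mfderiv 𝓘(ℝ, ℝ × E) (𝓘(ℝ, ℝ).prod 𝓘(ℝ, E))
      (extChartAt (𝓘(ℝ, ℝ).prod 𝓘(ℝ, E)) p).symm y =
      (ContinuousLinearMap.fst ℝ ℝ E).prod
        ((mfderiv 𝓘(ℝ, E) 𝓘(ℝ, E) (extChartAt 𝓘(ℝ, E) p.2).symm y.2 : E →L[ℝ] E).comp
          (ContinuousLinearMap.snd ℝ ℝ E)) := by
    rw [extChartAt_prod]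
    exact h4
  refine ContinuousLinearMap.ext fun v => ContinuousLinearMap.ext fun w => ?_
  let D : ℝ × E →L[ℝ] ℝ × E := mfderiv 𝓘(ℝ, ℝ × E) (𝓘(ℝ, ℝ).prod 𝓘(ℝ, E))
      (extChartAt (𝓘(ℝ, ℝ).prod 𝓘(ℝ, E)) p).symm y
  have hD : D = (ContinuousLinearMap.fst ℝ ℝ E).prod
        ((mfderiv 𝓘(ℝ, E) 𝓘(ℝ, E) (extChartAt 𝓘(ℝ, E) p.2).symm y.2 : E →L[ℝ] E).comp
          (ContinuousLinearMap.snd ℝ ℝ E)) := h6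
  have h7 : metricInChart (warpedMetric f hf hpos g) p y v w =
      (D v).1 * (D w).1 + f ((extChartAt 𝓘(ℝ, ℝ) p.1).symm y.1 : S) ^ 2 *
        (g.inner ((extChartAt 𝓘(ℝ, E) p.2).symm y.2) : E →L[ℝ] E →L[ℝ] ℝ) (D v).2 (D w).2 := rfl
  rw [h7, hD, h5]
  rfl

/-- The curvature tensor of the warped product `dθ² + f(θ)² g`. -/
theorem riemann_warpedMetric (f : ℝ → ℝ) (hf : ContDiff ℝ ∞ f)
    (hpos : ∀ θ ∈ S, 0 < f θ) (g : Metric 𝓘(ℝ, E) N) (p : S × N)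
    (B : E →L[ℝ] E →L[ℝ] ℝ) (hB : B = g.inner p.2) (u v w z : ℝ × E) :
    riemann (warpedMetric f hf hpos g) p u v w z =
      f p.1 ^ 2 * riemann g p.2 u.2 v.2 w.2 z.2
      - f p.1 ^ 2 * deriv f p.1 ^ 2 * (B u.2 w.2 * B v.2 z.2 - B u.2 z.2 * B v.2 w.2)
      - f p.1 * deriv (deriv f) p.1 *
        (u.1 * w.1 * B v.2 z.2 - u.1 * z.1 * B v.2 w.2
          - v.1 * w.1 * B u.2 z.2 + v.1 * z.1 * B u.2 w.2) := by
  have hy := mem_extChartAt_target (I := 𝓘(ℝ, ℝ).prod 𝓘(ℝ, E)) p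
  have hp : extChartAt (𝓘(ℝ, ℝ).prod 𝓘(ℝ, E)) p p = ((p.1 : ℝ), extChartAt 𝓘(ℝ, E) p.2 p.2) := by
    rw [extChartAt_prod]
    exact Prod.ext (extChartAt_opens_apply p.1 p.1) rfl
  have hev : metricInChart (warpedMetric f hf hpos g) p
      =ᶠ[𝓝 (extChartAt (𝓘(ℝ, ℝ).prod 𝓘(ℝ, E)) p p)]
      warpedChart f (metricInChart g p.2) := by
    filter_upwards [(isOpen_extChartAt_target p).mem_nhds hy] with q hq
    exact metricInChart_warpedMetric f hf hpos g p hq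
  refine (riemann_eq (warpedMetric f hf hpos g) p u v w z).trans ?_
  rw [curvatureOp_congr hev, hev.eq_of_nhds, hp]
  have h1 := apply_curvatureOp_warpedChart (f := f)
    (y := ((p.1 : ℝ), extChartAt 𝓘(ℝ, E) p.2 p.2))
    (isLocalMetric_metricInChart g p.2 (mem_extChartAt_target p.2)) hf (hpos _ p.1.2) u v w z
  have h2 : metricInChart g p.2 (extChartAt 𝓘(ℝ, E) p.2 p.2) = B := by
    rw [hB]
    exact ContinuousLinearMap.ext fun u => ContinuousLinearMap.ext fun v =>
      metricInChart_self g p.2 u v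
  rw [h1, riemann_eq, h2]
  ring

end Warped

/-! ### Comparing the identities on the warped product and on `N`. -/

section Trig

variable {E : Type*} [NormedAddCommGroup E] [NormedSpace ℝ E] [FiniteDimensional ℝ E]
  {N : Type*} [TopologicalSpace N] [ChartedSpace E N] [IsManifold 𝓘(ℝ, E) ∞ N]
  {S : TopologicalSpace.Opens ℝ}

theorem deriv_deriv_trig (α β θ : ℝ) :
    deriv (deriv fun θ : ℝ => α * Real.cos θ + β * Real.sin θ) θ =
      -(α * Real.cos θ + β * Real.sin θ) := by
  have h1 : deriv (fun θ : ℝ => α * Real.cos θ + β * Real.sin θ) =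
      fun θ => α * -Real.sin θ + β * Real.cos θ := by
    ext t
    exact (((Real.hasDerivAt_cos t).const_mul α).add ((Real.hasDerivAt_sin t).const_mul β)).deriv
  rw [h1]
  refine ((((Real.hasDerivAt_sin θ).neg).const_mul α).add
    ((Real.hasDerivAt_cos θ).const_mul β)).deriv.trans ?_
  ring

omit [FiniteDimensional ℝ E] in
-- Orthogonality together with `J² = -1` makes `J` skew-adjoint.
theorem AlmostHermitian.inner_J_right (h : AlmostHermitian 𝓘(ℝ, E) N) (q : N)
    (u v : TangentSpace 𝓘(ℝ, E) q) : h.g.inner q u (h.J q v) = -h.g.inner q (h.J q u) v := by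
  rw [← h.g_J_J q u, h.J_J, map_neg]

/-- The identity (K2), rewritten by means of the symmetries of the curvature tensor. -/
theorem AlmostHermitian.isK2_iff (h : AlmostHermitian 𝓘(ℝ, E) N) :
    h.IsK2 ↔ ∀ (q : N) (X Y Z W : TangentSpace 𝓘(ℝ, E) q),
      riemann h.g q X Y Z W =
        riemann h.g q (h.J q X) Y Z (h.J q W) + riemann h.g q X (h.J q Y) Z (h.J q W)
          + riemann h.g q X Y (h.J q Z) (h.J q W) := by
  refine forall_congr' fun q => ⟨fun H X Y Z W => ?_, fun H X Y Z W => ?_⟩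
  -- Reversing all four arguments preserves the curvature and moves the common `J` from the first
  -- slot to the fourth.
  · have := H W Z Y X
    rw [riemann_pair_symm h.g q X Y Z W, riemann_pair_symm h.g q X Y, riemann_pair_symm h.g q X,
      riemann_pair_symm h.g q _ Y Z] at this
    rw [this]
    ring
  · have := H W Z Y X
    rw [riemann_pair_symm h.g q X Y Z W, riemann_pair_symm h.g q _ Y Z,
      riemann_pair_symm h.g q _ Y, riemann_pair_symm h.g q _ _ Z W] at this
    rw [this]
    ring

variable {f : ℝ → ℝ} {hf : ContDiff ℝ ∞ f} {hpos : ∀ θ ∈ S, 0 < f θ}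

/-- The curvature tensor of a warped product whose warping function satisfies `f'' = -f`. -/
theorem riemann_warpedProduct (hf2 : ∀ θ, deriv (deriv f) θ = -f θ)
    (h : AlmostHermitian 𝓘(ℝ, E) N) (p : S × N) (B : E →L[ℝ] E →L[ℝ] ℝ)
    (hB : B = h.g.inner p.2) (u v w z : ℝ × E) :
    riemann (warpedProduct f hf hpos h).g p u v w z =
      f p.1 ^ 2 * riemann h.g p.2 u.2 v.2 w.2 z.2
      - f p.1 ^ 2 * deriv f p.1 ^ 2 * (B u.2 w.2 * B v.2 z.2 - B u.2 z.2 * B v.2 w.2)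
      + f p.1 ^ 2 * (u.1 * w.1 * B v.2 z.2 - u.1 * z.1 * B v.2 w.2
          - v.1 * w.1 * B u.2 z.2 + v.1 * z.1 * B u.2 w.2) := by
  refine (riemann_warpedMetric f hf hpos h.g p B hB u v w z).trans ?_
  rw [hf2]
  ring

theorem isG2_warpedProduct_iff (hS : (S : Set ℝ).Nonempty)
    (hf2 : ∀ θ, deriv (deriv f) θ = -f θ) (h : AlmostHermitian 𝓘(ℝ, E) N) :
    (warpedProduct f hf hpos h).IsG2 ↔ h.IsK2 := by
  rw [h.isK2_iff]
  -- The equivalence holds for each quadruple separately, whatever the `ξ`-components: every term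
  -- containing them cancels.
  have key : ∀ (p : S × N) (X Y Z W : ℝ × E),
      (riemann (warpedProduct f hf hpos h).g p X Y Z W =
        riemann (warpedProduct f hf hpos h).g p ((warpedProduct f hf hpos h).φ p X) Y Z
            ((warpedProduct f hf hpos h).φ p W)
          + riemann (warpedProduct f hf hpos h).g p X ((warpedProduct f hf hpos h).φ p Y) Z
            ((warpedProduct f hf hpos h).φ p W)
          + riemann (warpedProduct f hf hpos h).g p X Y ((warpedProduct f hf hpos h).φ p Z)
            ((warpedProduct f hf hpos h).φ p W)
          + (warpedProduct f hf hpos h).g.inner p X Z * (warpedProduct f hf hpos h).η p W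
            * (warpedProduct f hf hpos h).η p Y
          - (warpedProduct f hf hpos h).g.inner p Z Y * (warpedProduct f hf hpos h).η p X
            * (warpedProduct f hf hpos h).η p W) ↔
      riemann h.g p.2 X.2 Y.2 Z.2 W.2 =
        riemann h.g p.2 (h.J p.2 X.2) Y.2 Z.2 (h.J p.2 W.2)
          + riemann h.g p.2 X.2 (h.J p.2 Y.2) Z.2 (h.J p.2 W.2)
          + riemann h.g p.2 X.2 Y.2 (h.J p.2 Z.2) (h.J p.2 W.2) := by
    intro p X Y Z W
    obtain ⟨B, hB⟩ : ∃ B : E →L[ℝ] E →L[ℝ] ℝ, B = h.g.inner p.2 := ⟨_, rfl⟩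
    obtain ⟨J, hJ⟩ : ∃ J : E →L[ℝ] E, J = h.J p.2 := ⟨_, rfl⟩
    have hφ : ∀ V : ℝ × E, (warpedProduct f hf hpos h).φ p V = ((0, J V.2) : ℝ × E) := by
      subst hJ; exact fun V => rfl
    have hη : ∀ V : ℝ × E, (warpedProduct f hf hpos h).η p V = V.1 := fun V => rfl
    have hg : ∀ U V : ℝ × E, (warpedProduct f hf hpos h).g.inner p U V =
        U.1 * V.1 + f p.1 ^ 2 * B U.2 V.2 := by
      subst hB; exact fun U V => rfl
    have hs : ∀ u v : E, B u v = B v u := by subst hB; exact h.g.symm p.2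
    have hJJ : ∀ u v : E, B (J u) (J v) = B u v := by subst hB hJ; exact h.g_J_J p.2
    have hJr : ∀ u v : E, B u (J v) = -B (J u) v := by subst hB hJ; exact h.inner_J_right p.2
    have hR := riemann_warpedProduct (hf := hf) (hpos := hpos) hf2 h p B hB
    have hf0 : f p.1 ^ 2 ≠ 0 := (pow_pos (hpos _ p.1.2) 2).ne'
    rw [hφ, hφ, hφ, hφ, hη, hη, hη, hg, hg, hR, hR, hR, hR, ← hJ]
    -- Moving every `J` to the left argument makes the extra products in the constant-curvature part
    -- cancel in pairs.
    simp only [hJJ, hJr]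
    rw [hs Z.2 Y.2]
    constructor <;> intro H
    · refine mul_left_cancel₀ hf0 ?_
      linear_combination H
    · linear_combination f p.1 ^ 2 * H
  constructor
  · intro H q X Y Z W
    obtain ⟨θ, hθ⟩ := hS
    -- Any point of `S` serves, and vectors tangent to `N` suffice.
    exact (key (⟨θ, hθ⟩, q) (0, X) (0, Y) (0, Z) (0, W)).1 (H _ _ _ _ _)
  · intro H p X Y Z W
    exact (key p X Y Z W).2 (H _ _ _ _ _)

/-- With all four arguments rotated, orthogonality of `J` alone disposes of the constant-curvature
part. On the right only the correction terms contain `η`, and their purely `η` contributions cancel.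
-/
theorem isG3_warpedProduct_iff (hS : (S : Set ℝ).Nonempty)
    (hf2 : ∀ θ, deriv (deriv f) θ = -f θ) (h : AlmostHermitian 𝓘(ℝ, E) N) :
    (warpedProduct f hf hpos h).IsG3 ↔ h.IsK3 := by
  have key : ∀ (p : S × N) (X Y Z W : ℝ × E),
      (riemann (warpedProduct f hf hpos h).g p X Y Z W =
        riemann (warpedProduct f hf hpos h).g p ((warpedProduct f hf hpos h).φ p X)
            ((warpedProduct f hf hpos h).φ p Y) ((warpedProduct f hf hpos h).φ p Z)
            ((warpedProduct f hf hpos h).φ p W)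
          + (warpedProduct f hf hpos h).g.inner p X Z * (warpedProduct f hf hpos h).η p W
            * (warpedProduct f hf hpos h).η p Y
          - (warpedProduct f hf hpos h).g.inner p Z Y * (warpedProduct f hf hpos h).η p X
            * (warpedProduct f hf hpos h).η p W
          + (warpedProduct f hf hpos h).g.inner p Y W * (warpedProduct f hf hpos h).η p X
            * (warpedProduct f hf hpos h).η p Z
          - (warpedProduct f hf hpos h).g.inner p X W * (warpedProduct f hf hpos h).η p Y
            * (warpedProduct f hf hpos h).η p Z) ↔
      riemann h.g p.2 X.2 Y.2 Z.2 W.2 =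
        riemann h.g p.2 (h.J p.2 X.2) (h.J p.2 Y.2) (h.J p.2 Z.2) (h.J p.2 W.2) := by
    intro p X Y Z W
    obtain ⟨B, hB⟩ : ∃ B : E →L[ℝ] E →L[ℝ] ℝ, B = h.g.inner p.2 := ⟨_, rfl⟩
    obtain ⟨J, hJ⟩ : ∃ J : E →L[ℝ] E, J = h.J p.2 := ⟨_, rfl⟩
    have hφ : ∀ V : ℝ × E, (warpedProduct f hf hpos h).φ p V = ((0, J V.2) : ℝ × E) := by
      subst hJ; exact fun V => rfl
    have hη : ∀ V : ℝ × E, (warpedProduct f hf hpos h).η p V = V.1 := fun V => rfl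
    have hg : ∀ U V : ℝ × E, (warpedProduct f hf hpos h).g.inner p U V =
        U.1 * V.1 + f p.1 ^ 2 * B U.2 V.2 := by
      subst hB; exact fun U V => rfl
    have hs : ∀ u v : E, B u v = B v u := by subst hB; exact h.g.symm p.2
    have hJJ : ∀ u v : E, B (J u) (J v) = B u v := by subst hB hJ; exact h.g_J_J p.2
    have hR := riemann_warpedProduct (hf := hf) (hpos := hpos) hf2 h p B hB
    have hf0 : f p.1 ^ 2 ≠ 0 := (pow_pos (hpos _ p.1.2) 2).ne'
    rw [hφ, hφ, hφ, hφ, hη, hη, hη, hη, hg, hg, hg, hg, hR, hR, ← hJ]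
    simp only [hJJ]
    rw [hs Z.2 Y.2]
    constructor <;> intro H
    · refine mul_left_cancel₀ hf0 ?_
      linear_combination H
    · linear_combination f p.1 ^ 2 * H
  constructor
  · intro H q X Y Z W
    obtain ⟨θ, hθ⟩ := hS
    exact (key (⟨θ, hθ⟩, q) (0, X) (0, Y) (0, Z) (0, W)).1 (H _ _ _ _ _)
  · intro H p X Y Z W
    exact (key p X Y Z W).2 (H _ _ _ _ _)

end Trig
end GrayCurvature

theorem mainTheorem10
    {E : Type*} [NormedAddCommGroup E] [NormedSpace ℝ E] [FiniteDimensional ℝ E]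
    {N : Type*} [TopologicalSpace N] [T2Space N] [SecondCountableTopology N]
    [ChartedSpace E N] [IsManifold 𝓘(ℝ, E) ∞ N]
    (h : GrayCurvature.AlmostHermitian 𝓘(ℝ, E) N)
    (α β : ℝ) (S : TopologicalSpace.Opens ℝ) (hS : (S : Set ℝ).Nonempty)
    (hpos : ∀ θ ∈ S, 0 < α * Real.cos θ + β * Real.sin θ) :
    ((GrayCurvature.warpedProduct (fun θ : ℝ => α * Real.cos θ + β * Real.sin θ)
        (GrayCurvature.contDiff_trig α β) hpos h).IsG2 ↔ h.IsK2) ∧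
    ((GrayCurvature.warpedProduct (fun θ : ℝ => α * Real.cos θ + β * Real.sin θ)
        (GrayCurvature.contDiff_trig α β) hpos h).IsG3 ↔ h.IsK3) :=
  ⟨GrayCurvature.isG2_warpedProduct_iff hS (GrayCurvature.deriv_deriv_trig α β) h,
    GrayCurvature.isG3_warpedProduct_iff hS (GrayCurvature.deriv_deriv_trig α β) h⟩
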